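/- Let $(\mathcal X,\mathcal F)$ be a measurable space with countably generated $\sigma$-algebra, let $\pi$ be a probability measure on $\mathcal X$, and let $P$ be a Markov transition kernel on $\mathcal X$ that is reversible with respect to $\pi$. A measure $\mu$ is said to be in $L_2(\pi)$ if $\mu\ll\pi$ and $\int (d\mu/d\pi)^2\,d\pi<\infty$; for such measures $\mu,\nu$ put $\|\mu-\nu\|_2=\bigl(\int (\tfrac{d\mu}{d\pi}-\tfrac{d\nu}{d\pi})^2\,d\pi\bigr)^{1/2}$. Assume that $P$ is $L_2(\pi)$-geometrically ergodic with rate $1-\alpha$, where $0<\alpha<1$; that is, for every probability measure $\nu\in L_2(\pi)$ there is a constant $C_\nu<\infty$ with $\|\nu P^n-\pi\|_2\le C_\nu(1-\alpha)^n$ for all $n\ge 0$. Let $\mu\in L_2(\pi)$ be a probability measure, let $(X_k)_{k\ge 0}$ be a Markov chain with initial distribution $\mu$ and transition kernel $P$, let $f:\mathcal X\to\mathbb R$ satisfy $\int |f|^4\,d\pi<\infty$, and write $\pi(f)=\int f\,d\pi$ and $\|g\|_p=\bigl(\int|g|^p\,d\pi\bigr)^{1/p}$ for functions $g$. Then for every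 integer $t\ge 1$ the random variable $\bigl(\pi(f)-\frac1t\sum_{k=0}^{t-1}f(X_k)\bigr)^2$ is integrable and $$\mathbb E\left[\left(\pi(f)-\frac1t\sum_{k=0}^{t-1}f(X_k)\right)^2\right]\le \frac{2\,\|f-\pi(f)\|_2^2}{\alpha t}+\frac{2^{7/2}\,\|\mu-\pi\|_2\,\|f-\pi(f)\|_4^2}{\alpha^2t^2}.$$ -/

import Mathlib

open MeasureTheory ProbabilityTheory
open scoped ENNReal

/-- `μ ∈ L₂(π)` for a (positive) measure `μ`: it is absolutely continuous with respect to `π` and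
its density `dμ/dπ` is square integrable with respect to `π`. -/
def MeasureMemL2 {S : Type*} [MeasurableSpace S] (π μ : Measure S) : Prop :=
  μ ≪ π ∧ MemLp (fun x => (μ.rnDeriv π x).toReal) 2 π

/-- The distance `‖μ - ν‖₂ = (∫ (dμ/dπ - dν/dπ)² dπ)^(1/2)`, with values in `[0, ∞]`, for finite
measures `μ, ν ≪ π`. -/
noncomputable def measureL2Dist {S : Type*} [MeasurableSpace S] (π μ ν : Measure S) : ℝ≥0∞ :=
  eLpNorm (fun x => (μ.rnDeriv π x).toReal - (ν.rnDeriv π x).toReal) 2 π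

/-- `P` is `L₂(π)`-geometrically ergodic with geometric convergence rate `ρ`: for every probability
measure `μ ∈ L₂(π)` there is `C < ∞` with `‖μ Pⁿ - π‖₂ ≤ C ρⁿ` for all `n`.
Here `P ^ n ∘ₘ μ` is the measure `μ Pⁿ`; it is absolutely continuous with respect to `π` when
`μ` is and `π` is stationary for `P`. -/
def IsL2GeometricallyErgodic {S : Type*} [MeasurableSpace S] (P : Kernel S S) (π : Measure S)
    (ρ : ℝ) : Prop :=
  ∀ μ : Measure S, IsProbabilityMeasure μ → MeasureMemL2 π μ →
    ∃ C : ℝ, ∀ n : ℕ, measureL2Dist π ((P ^ n : Kernel S S) ∘ₘ μ) π ≤ ENNReal.ofReal (C * ρ ^ n)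

/-- The process `X₀, X₁, …` on the probability space `(Ω, Q)` is a (time-homogeneous) Markov chain
with initial distribution `μ` and transition kernel `P`: `X₀` has law `μ`, and the conditional
distribution of `X (n + 1)` given the history `(X₀, …, Xₙ)` is `P (Xₙ, ·)`. -/
structure IsMarkovChain {S Ω : Type*} [MeasurableSpace S] [MeasurableSpace Ω]
    (X : ℕ → Ω → S) (μ : Measure S) (P : Kernel S S) (Q : Measure Ω) : Prop where
  initial : HasLaw (X 0) μ Q
  step : ∀ n : ℕ, HasCondDistrib (X (n + 1)) (fun ω (i : Finset.Iic n) => X i ω)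
    (P.comap (fun h : Finset.Iic n → S => h ⟨n, Finset.mem_Iic.2 le_rfl⟩)
      (measurable_pi_apply _)) Q

/-!
The mean square error of the ergodic average is a normalised double sum of the covariances
`𝔼[g(X_j) g(X_{j+m})]` of the centred function `g = f - π(f)`. Reversibility makes `π ⊗ₘ Pⁿ`
symmetric, so `μ Pʲ` has the density `Pʲ d` with respect to `π`, where `d = dμ/dπ`, and
`𝔼[g(X_j) g(X_{j+m})] = ⟨g, Pᵐ g⟩ + ⟨g · Pᵐ g, Pʲ (d - 1)⟩` in `L²(π)`. Write `ρ = 1 - α`.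

*Spectral gap.* Geometric ergodicity bounds `‖Pⁿ h‖₂` by `C_h ρⁿ` for each centred `h ∈ L²(π)`
(`IsL2GeometricallyErgodic.exists_lpNorm_markovOp_le`). No spectral theorem is needed to remove the
dependence on `h`: symmetry gives `‖Pⁿ h‖₂² ≤ ‖h‖₂ ‖P²ⁿ h‖₂`, and iterating this doubling yields
`‖Pⁿ h‖₂ ≤ ρⁿ ‖h‖₂` (`IsL2GeometricallyErgodic.lpNorm_markovOp_pow_le`).

*Decay in `L⁴`.* The factor `g · Pᵐ g` is estimated by `‖g‖₄ ‖Pᵐ g‖₄`, so decay of `Pᵐ` in `L⁴` is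
required. It is interpolated between the spectral gap and the bound `2` of `Pᵐ - π` on `L^∞`:
truncating `g` at the level `s` compares the parts of `|Pᵐ g|` above `2 s` and of `|g|` above `s` in
`L²`, and integration against `s ds` gives `‖Pᵐ g‖₄ ≤ √2 ρ^(m/2) ‖g‖₄`
(`lpNorm_four_markovOp_sub_pow_le`).

*Summation.* Thus a covariance is at most `ρᵐ ‖g‖₂² + √2 ρʲ ρ^(m/2) ‖μ - π‖₂ ‖g‖₄²`
(`IsMarkovChain.integral_mul_le`), and summing the geometric series, with `1 - √ρ ≥ α / 2`, gives
the bound, in the second term even with half of the stated constant.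
-/

/-! ### Second and fourth moments -/

section Moments

variable {S : Type*} [MeasurableSpace S] {π : Measure S}

theorem lpNorm_two_sq {h : S → ℝ} (hh : MemLp h 2 π) : lpNorm h 2 π ^ 2 = ∫ x, h x ^ 2 ∂π := by
  have := lpNorm_nnreal_eq_integral_norm_rpow (p := 2) (by norm_num) hh.1
  have e : ((2 : NNReal) : ℝ≥0∞) = 2 := rfl
  rw [e] at this
  rw [this, ← Real.rpow_natCast, ← Real.rpow_mul (integral_nonneg fun x => by positivity)]
  norm_num

theorem lpNorm_four_pow {h : S → ℝ} (hh : MemLp h 4 π) :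
    lpNorm h 4 π ^ 4 = ∫ x, h x ^ 4 ∂π := by
  have := lpNorm_nnreal_eq_integral_norm_rpow (p := 4) (by norm_num) hh.1
  have e : ((4 : NNReal) : ℝ≥0∞) = 4 := rfl
  rw [e] at this
  rw [this, ← Real.rpow_natCast, ← Real.rpow_mul (integral_nonneg fun x => by positivity)]
  norm_num
  refine integral_congr_ae (Filter.Eventually.of_forall fun x => ?_)
  exact Even.pow_abs ⟨2, rfl⟩ _

theorem abs_integral_mul_le_lpNorm {h k : S → ℝ} (hh : MemLp h 2 π) (hk : MemLp k 2 π) :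
    |∫ x, h x * k x ∂π| ≤ lpNorm h 2 π * lpNorm k 2 π := by
  have hp : Real.HolderConjugate 2 2 := .two_two
  have e : ENNReal.ofReal 2 = 2 := by norm_num
  have := integral_mul_norm_le_Lp_mul_Lq (μ := π) hp (f := h) (g := k) (by rwa [e]) (by rwa [e])
  have f2 : ∀ {u : S → ℝ}, MemLp u 2 π →
      (∫ x, ‖u x‖ ^ (2 : ℝ) ∂π) ^ (1 / (2 : ℝ)) = lpNorm u 2 π := by
    intro u hu
    rw [← Real.sqrt_eq_rpow, ← Real.sqrt_sq (lpNorm_nonneg (f := u)), lpNorm_two_sq hu]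
    simp
  rw [f2 hh, f2 hk] at this
  refine (abs_integral_le_integral_abs).trans ?_
  simpa [abs_mul] using this

theorem MeasureTheory.MemLp.integrable_two_mul {h k : S → ℝ} (hh : MemLp h 2 π)
    (hk : MemLp k 2 π) : Integrable (fun x => h x * k x) π :=
  hh.integrable_mul hk

end Moments

/-! ### Reversible kernels -/

section Reversible

variable {S : Type*} [MeasurableSpace S]

theorem isMarkovKernel_pow (P : Kernel S S) [IsMarkovKernel P] (n : ℕ) :
    IsMarkovKernel (P ^ n) := by
  induction n with
  | zero => exact inferInstanceAs (IsMarkovKernel Kernel.id)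
  | succ n ih =>
    rw [pow_succ]
    exact inferInstanceAs (IsMarkovKernel ((P ^ n) ∘ₖ P))

/-- Reversibility says that the two-step law `π ⊗ₘ K` is symmetric. -/
theorem ProbabilityTheory.Kernel.IsReversible.measurePreserving_swap {K : Kernel S S}
    [IsMarkovKernel K] {π : Measure S} [IsProbabilityMeasure π] (h : K.IsReversible π) :
    MeasurePreserving Prod.swap (π ⊗ₘ K) (π ⊗ₘ K) := by
  refine ⟨measurable_swap, ?_⟩
  have : IsProbabilityMeasure ((π ⊗ₘ K).map Prod.swap) :=
    Measure.isProbabilityMeasure_map measurable_swap.aemeasurable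
  refine Measure.ext_prod fun {s t} hs ht => ?_
  rw [Measure.map_apply measurable_swap (hs.prod ht), Set.preimage_swap_prod,
    Measure.compProd_apply_prod ht hs, Measure.compProd_apply_prod hs ht]
  exact h ht hs

theorem ProbabilityTheory.Kernel.IsReversible.lintegral_mul_comm {K : Kernel S S}
    [IsMarkovKernel K] {π : Measure S} [IsProbabilityMeasure π] (h : K.IsReversible π)
    {u v : S → ℝ≥0∞} (hu : Measurable u) (hv : Measurable v) :
    ∫⁻ x, u x * ∫⁻ y, v y ∂K x ∂π = ∫⁻ x, v x * ∫⁻ y, u y ∂K x ∂π := by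
  have key : ∀ {a b : S → ℝ≥0∞}, Measurable a → Measurable b →
      ∫⁻ z, a z.1 * b z.2 ∂(π ⊗ₘ K) = ∫⁻ x, a x * ∫⁻ y, b y ∂K x ∂π := by
    intro a b ha hb
    rw [Measure.lintegral_compProd (f := fun z => a z.1 * b z.2) (by fun_prop)]
    refine lintegral_congr fun x => ?_
    exact lintegral_const_mul (a x) hb
  rw [← key hu hv, ← key hv hu]
  rw [← h.measurePreserving_swap.lintegral_comp (f := fun z => u z.1 * v z.2) (by fun_prop)]
  exact lintegral_congr fun z => mul_comm _ _

theorem ProbabilityTheory.Kernel.IsReversible.pow {P : Kernel S S} [IsMarkovKernel P]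
    {π : Measure S} [IsProbabilityMeasure π] (h : P.IsReversible π) (n : ℕ) :
    (P ^ n).IsReversible π := by
  have ind : ∀ (K : Kernel S S) [IsMarkovKernel K] (A B : Set S), MeasurableSet A →
      ∫⁻ x in A, K x B ∂π = ∫⁻ x, A.indicator 1 x * K x B ∂π := by
    intro K _ A B hA
    rw [← lintegral_indicator hA]
    refine lintegral_congr fun x => ?_
    by_cases hx : x ∈ A <;> simp [hx]
  induction n with
  | zero =>
    intro A B hA hB
    have h1 : ∀ (A B : Set S), MeasurableSet A → MeasurableSet B →
        ∫⁻ x in A, (P ^ 0) x B ∂π = π (B ∩ A) := by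
      intro A B hA hB
      have : ∀ x, (P ^ 0) x B = B.indicator 1 x := fun x => by
        rw [pow_zero]
        exact Kernel.id_apply x ▸ Measure.dirac_apply' x hB
      simp_rw [this]
      rw [lintegral_indicator_one hB, Measure.restrict_apply hB]
    rw [h1 A B hA hB, h1 B A hB hA, Set.inter_comm]
  | succ n ih =>
    intro A B hA hB
    have := isMarkovKernel_pow P n
    have := isMarkovKernel_pow P (n + 1)
    rw [ind _ A B hA, ind _ B A hB]
    have e1 : ∀ x, (P ^ (n + 1)) x B = ∫⁻ y, P y B ∂(P ^ n) x := fun x =>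
      Kernel.pow_succ_apply_eq_lintegral _ _ _ hB
    have e2 : ∀ x, (P ^ (n + 1)) x A = ∫⁻ y, (P ^ n) y A ∂P x := fun x => by
      rw [add_comm, Kernel.pow_add_apply_eq_lintegral _ _ _ _ hA, pow_one]
    have hi : ∀ {C : Set S}, MeasurableSet C → Measurable (C.indicator (1 : S → ℝ≥0∞)) :=
      fun hC => measurable_one.indicator hC
    simp_rw [e1, e2]
    rw [ih.lintegral_mul_comm (hi hA) (Kernel.measurable_coe P hB),
      h.lintegral_mul_comm (hi hB) (Kernel.measurable_coe (P ^ n) hA)]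
    refine lintegral_congr fun x => ?_
    rw [lintegral_indicator_one hA, lintegral_indicator_one hB, mul_comm]

/-! ### The Markov operator on `Lᵖ(π)` -/

/-- The operator `h ↦ K h`, `(K h)(x) = ∫ h(y) K(x, dy)`, of a kernel acting on real functions;
it has the junk value `0` at those `x` where `h` is not integrable against `K(x, ·)`. -/
noncomputable def markovOp (K : Kernel S S) (h : S → ℝ) (x : S) : ℝ := ∫ y, h y ∂K x

theorem measurable_markovOp (K : Kernel S S) {h : S → ℝ} (hh : Measurable h) :
    Measurable (markovOp K h) :=
  (hh.stronglyMeasurable.integral_kernel (κ := K)).measurable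

theorem ae_integrable_kernel {K : Kernel S S} {π : Measure S} (hK : K.Invariant π)
    {h : S → ℝ} (hi : Integrable h π) :
    ∀ᵐ x ∂π, Integrable h (K x) := by
  refine Measure.ae_integrable_of_integrable_comp ?_
  rwa [hK.def]

theorem integral_markovOp {K : Kernel S S} [IsMarkovKernel K] {π : Measure S} 
    [IsProbabilityMeasure π] (hK : K.Invariant π) {h : S → ℝ} (hi : Integrable h π) :
    ∫ x, markovOp K h x ∂π = ∫ x, h x ∂π := by
  have hs : MeasurePreserving Prod.snd (π ⊗ₘ K) π :=
    ⟨measurable_snd, (Measure.snd_compProd π K).trans hK.def⟩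
  have h2 : Integrable (fun z => h z.2) (π ⊗ₘ K) := hs.integrable_comp_of_integrable hi
  have h1 := Measure.integral_compProd h2
  have h3 := integral_map (μ := π ⊗ₘ K) hs.measurable.aemeasurable (f := h)
    (by rw [hs.map_eq]; exact hi.1)
  rw [hs.map_eq] at h3
  exact (h3.trans h1).symm

theorem markovOp_sub_ae {K : Kernel S S} {π : Measure S} (hK : K.Invariant π)
    {h k : S → ℝ} (hh : Integrable h π)
    (hk : Integrable k π) :
    markovOp K (fun x => h x - k x) =ᵐ[π] fun x => markovOp K h x - markovOp K k x := by
  filter_upwards [ae_integrable_kernel hK hh, ae_integrable_kernel hK hk] with x h1 h2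
  exact integral_sub h1 h2

theorem markovOp_const_mul (K : Kernel S S) (c : ℝ) (h : S → ℝ) :
    markovOp K (fun x => c * h x) = fun x => c * markovOp K h x :=
  funext fun _ => integral_const_mul _ _

theorem markovOp_const (K : Kernel S S) [IsMarkovKernel K] (c : ℝ) :
    markovOp K (fun _ => c) = fun _ => c := by
  funext x; simp [markovOp]

/-- Jensen's inequality: a Markov operator with invariant law `π` is a contraction of `Lᵖ(π)`. -/
theorem eLpNorm_markovOp_le {K : Kernel S S} [IsMarkovKernel K] {π : Measure S} 
    (hK : K.Invariant π) {h : S → ℝ} (hh : Measurable h)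
    {p : ℝ≥0∞} (hp : 1 ≤ p) (hp' : p ≠ ∞) :
    eLpNorm (markovOp K h) p π ≤ eLpNorm h p π := by
  have hp0 : p ≠ 0 := (zero_lt_one.trans_le hp).ne'
  have hpr : 0 < p.toReal := ENNReal.toReal_pos hp0 hp'
  rw [eLpNorm_eq_lintegral_rpow_enorm_toReal hp0 hp',
    eLpNorm_eq_lintegral_rpow_enorm_toReal hp0 hp']
  gcongr ?_ ^ _
  have h1 : ∀ x, ‖markovOp K h x‖ₑ ^ p.toReal ≤ ∫⁻ y, ‖h y‖ₑ ^ p.toReal ∂K x := by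
    intro x
    have a1 : ‖markovOp K h x‖ₑ ≤ eLpNorm h p (K x) :=
      (enorm_integral_le_lintegral_enorm _).trans
        (by rw [← eLpNorm_one_eq_lintegral_enorm]
            exact eLpNorm_le_eLpNorm_of_exponent_le hp hh.aestronglyMeasurable)
    rw [eLpNorm_eq_lintegral_rpow_enorm_toReal hp0 hp'] at a1
    calc _ ≤ _ := ENNReal.rpow_le_rpow a1 hpr.le
      _ = _ := by rw [← ENNReal.rpow_mul, one_div, inv_mul_cancel₀ hpr.ne', ENNReal.rpow_one]
  calc _ ≤ _ := lintegral_mono h1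
    _ = _ := by
      rw [← Measure.lintegral_bind K.aemeasurable
        ((hh.enorm.pow_const _).aemeasurable), hK.def]

theorem memLp_markovOp {K : Kernel S S} [IsMarkovKernel K] {π : Measure S} 
    (hK : K.Invariant π) {h : S → ℝ} (hh : Measurable h)
    {p : ℝ≥0∞} (hp : 1 ≤ p) (hp' : p ≠ ∞) (hL : MemLp h p π) : MemLp (markovOp K h) p π :=
  ⟨(measurable_markovOp K hh).aestronglyMeasurable,
    (eLpNorm_markovOp_le hK hh hp hp').trans_lt hL.2⟩

theorem lpNorm_markovOp_le {K : Kernel S S} [IsMarkovKernel K] {π : Measure S} 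
    (hK : K.Invariant π) {h : S → ℝ} (hh : Measurable h)
    {p : ℝ≥0∞} (hp : 1 ≤ p) (hp' : p ≠ ∞) (hL : MemLp h p π) :
    lpNorm (markovOp K h) p π ≤ lpNorm h p π := by
  rw [← toReal_eLpNorm hL.1, ← toReal_eLpNorm (memLp_markovOp hK hh hp hp' hL).1]
  exact ENNReal.toReal_mono hL.2.ne (eLpNorm_markovOp_le hK hh hp hp')

/-- Symmetry of the reversible Markov operator on `L²(π)`. -/
theorem integral_markovOp_mul_comm {K : Kernel S S} [IsMarkovKernel K] {π : Measure S} 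
    [IsProbabilityMeasure π] (h : K.IsReversible π) {u v : S → ℝ} (hu2 : MemLp u 2 π)
    (hv2 : MemLp v 2 π) :
    ∫ x, markovOp K u x * v x ∂π = ∫ x, u x * markovOp K v x ∂π := by
  have hinv := h.invariant
  have hf : MeasurePreserving Prod.fst (π ⊗ₘ K) π :=
    ⟨measurable_fst, Measure.fst_compProd π K⟩
  have hs : MeasurePreserving Prod.snd (π ⊗ₘ K) π :=
    ⟨measurable_snd, (Measure.snd_compProd π K).trans hinv.def⟩
  have key : ∀ {a b : S → ℝ}, MemLp a 2 π → MemLp b 2 π →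
      ∫ z, a z.1 * b z.2 ∂(π ⊗ₘ K) = ∫ x, a x * markovOp K b x ∂π := by
    intro a b ha hb
    rw [Measure.integral_compProd]
    · refine integral_congr_ae (Filter.Eventually.of_forall fun x => ?_)
      simp only [markovOp, integral_const_mul]
    · exact (ha.comp_measurePreserving hf).integrable_mul (hb.comp_measurePreserving hs)
  have hm : MeasurePreserving (MeasurableEquiv.prodComm : S × S ≃ᵐ S × S) (π ⊗ₘ K) (π ⊗ₘ K) :=
    h.measurePreserving_swap
  rw [← key hu2 hv2, ← hm.integral_comp']
  calc _ = ∫ x, v x * markovOp K u x ∂π := by simp_rw [mul_comm]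
    _ = ∫ z, v z.1 * u z.2 ∂(π ⊗ₘ K) := (key hv2 hu2).symm
    _ = _ := integral_congr_ae (Filter.Eventually.of_forall fun z => mul_comm _ _)

theorem markovOp_pow_add_ae {P : Kernel S S} [IsMarkovKernel P] {π : Measure S}
    [IsProbabilityMeasure π] (h : P.IsReversible π) (m n : ℕ)
    {u : S → ℝ} (hu : Integrable u π) :
    markovOp (P ^ (m + n)) u =ᵐ[π] markovOp (P ^ n) (markovOp (P ^ m) u) := by
  have := isMarkovKernel_pow P (m + n)
  filter_upwards [ae_integrable_kernel (h.pow (m + n)).invariant hu] with x hx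
  rw [Kernel.pow_add] at hx
  simp only [markovOp, Kernel.pow_add]
  exact Kernel.integral_comp hx

end Reversible

/-! ### Densities and geometric ergodicity -/

section Density

variable {S : Type*} [MeasurableSpace S]

/-- A reversible kernel acts on densities in the same way as on functions. -/
theorem comp_withDensity_of_isReversible {K : Kernel S S} [IsMarkovKernel K] {π : Measure S}
    [IsProbabilityMeasure π] (h : K.IsReversible π) {u : S → ℝ≥0∞} (hu : Measurable u) :
    K ∘ₘ (π.withDensity u) = π.withDensity (fun x => ∫⁻ y, u y ∂K x) := by
  ext s hs
  rw [Measure.bind_apply hs K.aemeasurable, withDensity_apply _ hs,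
    lintegral_withDensity_eq_lintegral_mul _ hu (Kernel.measurable_coe K hs),
    ← lintegral_indicator hs]
  calc ∫⁻ x, u x * K x s ∂π = ∫⁻ x, u x * ∫⁻ y, s.indicator 1 y ∂K x ∂π := by
        refine lintegral_congr fun x => ?_
        rw [lintegral_indicator_one hs]
    _ = ∫⁻ x, s.indicator 1 x * ∫⁻ y, u y ∂K x ∂π :=
        h.lintegral_mul_comm hu (measurable_one.indicator hs)
    _ = _ := by
        refine lintegral_congr fun x => ?_
        by_cases hx : x ∈ s <;> simp [hx]

theorem toReal_rnDeriv_comp_withDensity {K : Kernel S S} [IsMarkovKernel K] {π : Measure S}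
    [IsProbabilityMeasure π] (h : K.IsReversible π) {p : S → ℝ} (hp : Measurable p)
    (hp0 : ∀ x, 0 ≤ p x) :
    (fun x => ((K ∘ₘ π.withDensity (fun x => ENNReal.ofReal (p x))).rnDeriv π x).toReal)
      =ᵐ[π] markovOp K p := by
  rw [comp_withDensity_of_isReversible h hp.ennreal_ofReal]
  have hm : Measurable fun x => ∫⁻ y, ENNReal.ofReal (p y) ∂K x :=
    hp.ennreal_ofReal.lintegral_kernel
  filter_upwards [Measure.rnDeriv_withDensity π hm] with x hx
  rw [hx, markovOp, integral_eq_lintegral_of_nonneg_ae (Filter.Eventually.of_forall hp0)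
    hp.aestronglyMeasurable]

theorem measureL2Dist_comp_withDensity {K : Kernel S S} [IsMarkovKernel K] {π : Measure S}
    [IsProbabilityMeasure π] (h : K.IsReversible π) {p : S → ℝ} (hp : Measurable p)
    (hp0 : ∀ x, 0 ≤ p x) :
    measureL2Dist π (K ∘ₘ π.withDensity (fun x => ENNReal.ofReal (p x))) π
      = eLpNorm (fun x => markovOp K p x - 1) 2 π := by
  refine eLpNorm_congr_ae ?_
  filter_upwards [toReal_rnDeriv_comp_withDensity h hp hp0, Measure.rnDeriv_self π] with x h1 h2
  rw [h1, h2]; simp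

theorem MeasureMemL2.withDensity_toReal_rnDeriv {π μ : Measure S} [IsProbabilityMeasure π]
    [IsProbabilityMeasure μ] (h : MeasureMemL2 π μ) :
    π.withDensity (fun x => ENNReal.ofReal (μ.rnDeriv π x).toReal) = μ := by
  conv_rhs => rw [← Measure.withDensity_rnDeriv_eq μ π h.1]
  refine withDensity_congr_ae ?_
  filter_upwards [Measure.rnDeriv_lt_top μ π] with x hx
  exact ENNReal.ofReal_toReal hx.ne

theorem IsL2GeometricallyErgodic.exists_lpNorm_density_le {P : Kernel S S} [IsMarkovKernel P]
    {π : Measure S} [IsProbabilityMeasure π] (hrev : P.IsReversible π) {ρ : ℝ} (hρ : 0 ≤ ρ)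
    (hgeo : IsL2GeometricallyErgodic P π ρ) {p : S → ℝ} (hp : Measurable p)
    (hp0 : ∀ x, 0 ≤ p x) (hp2 : MemLp p 2 π) (hp1 : ∫ x, p x ∂π = 1) :
    ∃ C : ℝ, ∀ n : ℕ, lpNorm (fun x => markovOp (P ^ n) p x - 1) 2 π ≤ C * ρ ^ n := by
  have hI : Integrable p π := hp2.integrable one_le_two
  have hprob : IsProbabilityMeasure (π.withDensity (fun x => ENNReal.ofReal (p x))) := by
    constructor
    rw [withDensity_apply _ .univ, Measure.restrict_univ,
      ← ofReal_integral_eq_lintegral_ofReal hI (Filter.Eventually.of_forall hp0), hp1]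
    simp
  have hmem : MeasureMemL2 π (π.withDensity (fun x => ENNReal.ofReal (p x))) := by
    refine ⟨withDensity_absolutelyContinuous _ _, (memLp_congr_ae ?_).2 hp2⟩
    filter_upwards [Measure.rnDeriv_withDensity π hp.ennreal_ofReal] with x hx
    rw [hx, ENNReal.toReal_ofReal (hp0 x)]
  obtain ⟨C, hC⟩ := hgeo _ hprob hmem
  refine ⟨max C 0, fun n => ?_⟩
  have := isMarkovKernel_pow P n
  have h1 := hC n
  rw [measureL2Dist_comp_withDensity (hrev.pow n) hp hp0] at h1
  have hm : Measurable fun x => markovOp (P ^ n) p x - 1 := (measurable_markovOp _ hp).sub_const 1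
  rw [← toReal_eLpNorm hm.aestronglyMeasurable]
  refine ENNReal.toReal_le_of_le_ofReal (by positivity) (h1.trans (ENNReal.ofReal_le_ofReal ?_))
  gcongr
  exact le_max_left _ _

theorem memLp_const_mul_one_add_max {π : Measure S} [IsProbabilityMeasure π] {k : S → ℝ}
    (hk : MemLp k 2 π) (a : ℝ) : MemLp (fun x => a * (1 + max (k x) 0)) 2 π := by
  have h1 : MemLp (fun x => max (k x) 0) 2 π := hk.pos_part
  have h2 : MemLp (fun x => 1 + max (k x) 0) 2 π := (memLp_const (1 : ℝ)).add h1
  exact h2.const_mul a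

/-- Every centred `h ∈ L²(π)` is a multiple of a difference of two probability densities, so
geometric ergodicity makes `Pⁿ h` decay geometrically, with a constant that may depend on `h`. -/
theorem IsL2GeometricallyErgodic.exists_lpNorm_markovOp_le {P : Kernel S S} [IsMarkovKernel P]
    {π : Measure S} [IsProbabilityMeasure π] (hrev : P.IsReversible π) {ρ : ℝ} (hρ : 0 ≤ ρ)
    (hgeo : IsL2GeometricallyErgodic P π ρ) {h : S → ℝ} (hh : Measurable h)
    (hh2 : MemLp h 2 π) (hh0 : ∫ x, h x ∂π = 0) :
    ∃ C : ℝ, ∀ n : ℕ, lpNorm (markovOp (P ^ n) h) 2 π ≤ C * ρ ^ n := by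
  have hI : Integrable h π := hh2.integrable one_le_two
  -- `c` is the common mass of `h⁺` and `h⁻`; adding `1` keeps the normalisation nonzero.
  set c : ℝ := ∫ x, max (h x) 0 ∂π with hc
  have hpI : Integrable (fun x => max (h x) 0) π := hI.pos_part
  have hnI : Integrable (fun x => max (-h x) 0) π := hI.neg_part
  have hc' : ∫ x, max (-h x) 0 ∂π = c := by
    have : ∫ x, (max (h x) 0 - max (-h x) 0) ∂π = 0 := by
      simp_rw [max_zero_sub_eq_self, hh0]
    rw [integral_sub hpI hnI] at this
    linarith
  have hc0 : 0 ≤ c := integral_nonneg fun x => le_max_right _ _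
  have hc1 : 1 + c ≠ 0 := by positivity
  have dens : ∀ {k : S → ℝ}, Measurable k → MemLp k 2 π → ∫ x, max (k x) 0 ∂π = c →
      ∃ C : ℝ, ∀ n : ℕ,
        lpNorm (fun x => markovOp (P ^ n) (fun x => (1 + c)⁻¹ * (1 + max (k x) 0)) x - 1) 2 π
          ≤ C * ρ ^ n := by
    intro k hk hk2 hkc
    have hm2 : MemLp (fun x => max (k x) 0) 2 π := hk2.pos_part
    refine hgeo.exists_lpNorm_density_le hrev hρ (by fun_prop) (fun x => by positivity)
      (memLp_const_mul_one_add_max hk2 _) ?_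
    rw [integral_const_mul, integral_add (integrable_const _) (hm2.integrable one_le_two), hkc]
    simp [hc1]
  obtain ⟨C₁, h₁⟩ := dens hh hh2 rfl
  obtain ⟨C₂, h₂⟩ := dens hh.neg hh2.neg hc'
  refine ⟨(1 + c) * (C₁ + C₂), fun n => ?_⟩
  have := isMarkovKernel_pow P n
  set u : S → ℝ := fun x => (1 + c)⁻¹ * (1 + max (h x) 0) with hu
  set v : S → ℝ := fun x => (1 + c)⁻¹ * (1 + max ((-h) x) 0) with hv
  have hinv := (hrev.pow n).invariant
  have hum : Measurable u := by fun_prop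
  have hvm : Measurable v := by
    have : Measurable (-h) := hh.neg
    fun_prop
  have hu2 : MemLp u 2 π := memLp_const_mul_one_add_max hh2 _
  have hv2 : MemLp v 2 π := memLp_const_mul_one_add_max hh2.neg _
  have heq : h = fun x => (1 + c) * (u x - v x) := by
    funext x
    have := max_zero_sub_eq_self (h x)
    simp only [hu, hv, Pi.neg_apply]
    field_simp
    linarith
  have hu2' : MemLp (fun x => markovOp (P ^ n) u x - 1) 2 π :=
    (memLp_markovOp hinv hum one_le_two (by simp) hu2).sub (memLp_const 1)
  have hv2' : MemLp (fun x => markovOp (P ^ n) v x - 1) 2 π :=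
    (memLp_markovOp hinv hvm one_le_two (by simp) hv2).sub (memLp_const 1)
  have hae : markovOp (P ^ n) h =ᵐ[π]
      (1 + c) • ((fun x => markovOp (P ^ n) u x - 1) - fun x => markovOp (P ^ n) v x - 1) := by
    conv_lhs => rw [heq, markovOp_const_mul]
    filter_upwards [markovOp_sub_ae hinv (hu2.integrable one_le_two)
      (hv2.integrable one_le_two)] with x hx
    simp only [hx, Pi.smul_apply, Pi.sub_apply, smul_eq_mul]
    ring
  have hle : lpNorm (markovOp (P ^ n) h) 2 π =
      lpNorm ((1 + c) • ((fun x => markovOp (P ^ n) u x - 1) -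
        fun x => markovOp (P ^ n) v x - 1)) 2 π := by
    rw [← toReal_eLpNorm (measurable_markovOp _ hh).aestronglyMeasurable,
      ← toReal_eLpNorm ((hu2'.sub hv2').const_smul _).1, eLpNorm_congr_ae hae]
  rw [hle, lpNorm_const_smul, coe_nnnorm, Real.norm_of_nonneg (by positivity), mul_assoc]
  refine mul_le_mul_of_nonneg_left ?_ (by positivity)
  rw [add_mul]
  exact (lpNorm_sub_le hu2' one_le_two).trans (add_le_add (h₁ n) (h₂ n))

/-! ### The spectral gap -/

/-- If `aₙ² ≤ H a₂ₙ`, then an a priori bound `aₙ ≤ C ρⁿ` improves to `aₙ ≤ H ρⁿ`: iterated doubling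
bounds all the powers `(aₙ / (H ρⁿ)) ^ 2ᵏ` by the same constant. -/
theorem le_mul_pow_of_sq_le_mul_double {a : ℕ → ℝ} {H C ρ : ℝ} (hH : 0 < H) (hρ : 0 < ρ)
    (ha : ∀ n, 0 ≤ a n) (hdbl : ∀ n, a n ^ 2 ≤ H * a (2 * n)) (hC : ∀ n, a n ≤ C * ρ ^ n) (n : ℕ) :
    a n ≤ H * ρ ^ n := by
  set b : ℕ → ℝ := fun n => a n / (H * ρ ^ n) with hb
  have hb0 : ∀ n, 0 ≤ b n := fun n => div_nonneg (ha n) (by positivity)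
  have hb2 : ∀ n, b n ^ 2 ≤ b (2 * n) := fun n => by
    rw [hb]
    simp only
    rw [div_pow, div_le_div_iff₀ (by positivity) (by positivity)]
    have e : (H * ρ ^ n) ^ 2 = H * (H * ρ ^ (2 * n)) := by ring
    rw [e]
    have := mul_le_mul_of_nonneg_right (hdbl n) (show 0 ≤ H * ρ ^ (2 * n) by positivity)
    linarith
  have hbC : ∀ n, b n ≤ C / H := fun n => by
    rw [hb]
    simp only
    rw [div_le_div_iff₀ (by positivity) hH]
    have := mul_le_mul_of_nonneg_right (hC n) hH.le
    linarith
  have hbk : ∀ k, b n ^ 2 ^ k ≤ b (2 ^ k * n) := by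
    intro k
    induction k with
    | zero => simp
    | succ k ih =>
      calc b n ^ 2 ^ (k + 1) = (b n ^ 2 ^ k) ^ 2 := by rw [← pow_mul, pow_succ]
        _ ≤ b (2 ^ k * n) ^ 2 := by
          have := hb0 n
          gcongr
        _ ≤ b (2 * (2 ^ k * n)) := hb2 _
        _ = _ := by rw [pow_succ]; congr 1; ring
  have h1 : b n ≤ 1 := by
    by_contra! hlt
    obtain ⟨k, hk⟩ := pow_unbounded_of_one_lt (C / H) hlt
    have : b n ^ k ≤ b n ^ 2 ^ k := pow_le_pow_right₀ hlt.le k.lt_two_pow_self.le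
    linarith [hbk k, hbC (2 ^ k * n)]
  rwa [hb, div_le_one (by positivity)] at h1

/-- `‖K h‖² = ⟨h, K² h⟩ ≤ ‖h‖ ‖K² h‖` for the `n`-step kernel `K = Pⁿ`. -/
theorem lpNorm_markovOp_pow_sq_le {P : Kernel S S} [IsMarkovKernel P] {π : Measure S}
    [IsProbabilityMeasure π] (hrev : P.IsReversible π) {h : S → ℝ} (hh : Measurable h)
    (hh2 : MemLp h 2 π) (n : ℕ) :
    lpNorm (markovOp (P ^ n) h) 2 π ^ 2
      ≤ lpNorm h 2 π * lpNorm (markovOp (P ^ (2 * n)) h) 2 π := by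
  have := isMarkovKernel_pow P n
  have := isMarkovKernel_pow P (2 * n)
  have hn := memLp_markovOp (hrev.pow n).invariant hh one_le_two (by simp) hh2
  have h2n := memLp_markovOp (hrev.pow (2 * n)).invariant hh one_le_two (by simp) hh2
  rw [lpNorm_two_sq hn]
  calc ∫ x, markovOp (P ^ n) h x ^ 2 ∂π
      = ∫ x, markovOp (P ^ n) h x * markovOp (P ^ n) h x ∂π := by simp_rw [sq]
    _ = ∫ x, h x * markovOp (P ^ n) (markovOp (P ^ n) h) x ∂π :=
        integral_markovOp_mul_comm (hrev.pow n) hh2 hn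
    _ = ∫ x, h x * markovOp (P ^ (2 * n)) h x ∂π := by
        refine integral_congr_ae ?_
        filter_upwards [markovOp_pow_add_ae hrev n n (hh2.integrable one_le_two)] with x hx
        rw [two_mul, hx]
    _ ≤ _ := (le_abs_self _).trans (abs_integral_mul_le_lpNorm hh2 h2n)

/-- For a reversible kernel, `L²`-geometric ergodicity is a spectral gap: `Pⁿ` contracts the
centred functions in `L²(π)` by the factor `ρⁿ`. -/
theorem IsL2GeometricallyErgodic.lpNorm_markovOp_pow_le {P : Kernel S S} [IsMarkovKernel P]
    {π : Measure S} [IsProbabilityMeasure π] (hrev : P.IsReversible π) {ρ : ℝ} (hρ : 0 < ρ)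
    (hgeo : IsL2GeometricallyErgodic P π ρ) {h : S → ℝ} (hh : Measurable h)
    (hh2 : MemLp h 2 π) (hh0 : ∫ x, h x ∂π = 0) (n : ℕ) :
    lpNorm (markovOp (P ^ n) h) 2 π ≤ ρ ^ n * lpNorm h 2 π := by
  rw [mul_comm]
  have := isMarkovKernel_pow P n
  rcases (lpNorm_nonneg (f := h) (p := 2) (μ := π)).eq_or_lt with h0 | hpos
  · have := lpNorm_markovOp_le (hrev.pow n).invariant hh one_le_two (by simp) hh2
    rw [← h0] at this ⊢
    simpa using this
  · obtain ⟨C, hC⟩ := hgeo.exists_lpNorm_markovOp_le hrev hρ.le hh hh2 hh0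
    exact le_mul_pow_of_sq_le_mul_double (a := fun n => lpNorm (markovOp (P ^ n) h) 2 π) hpos hρ
      (fun n => lpNorm_nonneg) (lpNorm_markovOp_pow_sq_le hrev hh hh2) hC n

theorem lpNorm_sub_integral_le {π : Measure S} [IsProbabilityMeasure π] {h : S → ℝ}
    (hh2 : MemLp h 2 π) : lpNorm (fun x => h x - ∫ y, h y ∂π) 2 π ≤ lpNorm h 2 π := by
  have h1 : MemLp (fun x => h x - ∫ y, h y ∂π) 2 π := hh2.sub (memLp_const _)
  refine le_of_sq_le_sq ?_ lpNorm_nonneg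
  rw [lpNorm_two_sq h1, lpNorm_two_sq hh2]
  have hI : Integrable h π := hh2.integrable one_le_two
  set m := ∫ y, h y ∂π with hm
  have e : ∀ x, (h x - m) ^ 2 = h x ^ 2 - (2 * m * h x - m ^ 2) := fun x => by ring
  simp_rw [e]
  have hI2 : Integrable (fun x => 2 * m * h x - m ^ 2) π :=
    (hI.const_mul _).sub (integrable_const _)
  rw [integral_sub hh2.integrable_sq hI2, integral_sub (hI.const_mul _) (integrable_const _),
    integral_const_mul, ← hm]
  simp
  nlinarith [sq_nonneg m]

theorem IsL2GeometricallyErgodic.lpNorm_markovOp_pow_sub_le {P : Kernel S S} [IsMarkovKernel P]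
    {π : Measure S} [IsProbabilityMeasure π] (hrev : P.IsReversible π) {ρ : ℝ} (hρ : 0 < ρ)
    (hgeo : IsL2GeometricallyErgodic P π ρ) {h : S → ℝ} (hh : Measurable h)
    (hh2 : MemLp h 2 π) (n : ℕ) :
    lpNorm (fun x => markovOp (P ^ n) h x - ∫ y, h y ∂π) 2 π ≤ ρ ^ n * lpNorm h 2 π := by
  have := isMarkovKernel_pow P n
  have hI : Integrable h π := hh2.integrable one_le_two
  have h1 : MemLp (fun x => h x - ∫ y, h y ∂π) 2 π := hh2.sub (memLp_const _)
  have h2 := hgeo.lpNorm_markovOp_pow_le hrev hρ (hh.sub_const (∫ y, h y ∂π)) h1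
    (by rw [integral_sub hI (integrable_const _)]; simp) n
  have hae := markovOp_sub_ae (hrev.pow n).invariant hI (integrable_const (∫ y, h y ∂π))
  rw [markovOp_const] at hae
  have e : lpNorm (fun x => markovOp (P ^ n) h x - ∫ y, h y ∂π) 2 π
      = lpNorm (markovOp (P ^ n) (fun x => h x - ∫ y, h y ∂π)) 2 π := by
    rw [← toReal_eLpNorm ((measurable_markovOp _ hh).sub_const _).aestronglyMeasurable,
      ← toReal_eLpNorm (measurable_markovOp _ (hh.sub_const _)).aestronglyMeasurable,
      eLpNorm_congr_ae hae]
  rw [e]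
  exact h2.trans (mul_le_mul_of_nonneg_left (lpNorm_sub_integral_le hh2) (by positivity))

end Density

/-! ### Interpolation between `L²` and `L^∞` at the exponent four -/

section Interpolation

variable {S : Type*} [MeasurableSpace S]

theorem lintegral_mul_sq_truncated {a b : ℝ} (ha : 0 ≤ a) (hb : 0 < b) :
    ∫⁻ s in Set.Ioi (0 : ℝ), ENNReal.ofReal (s * max (a - b * s) 0 ^ 2)
      = ENNReal.ofReal (a ^ 4 / (12 * b ^ 2)) := by
  have hab : 0 ≤ a / b := by positivity
  have h1 : ∫⁻ s in Set.Ioi (0 : ℝ), ENNReal.ofReal (s * max (a - b * s) 0 ^ 2)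
      = ∫⁻ s in Set.Ioc 0 (a / b), ENNReal.ofReal (s * (a - b * s) ^ 2) := by
    rw [← lintegral_indicator measurableSet_Ioi, ← lintegral_indicator measurableSet_Ioc]
    refine lintegral_congr fun s => ?_
    by_cases h0 : 0 < s
    · rw [Set.indicator_of_mem (Set.mem_Ioi.2 h0)]
      by_cases h2 : s ≤ a / b
      · rw [Set.indicator_of_mem (Set.mem_Ioc.2 ⟨h0, h2⟩), max_eq_left]
        rw [le_div_iff₀ hb] at h2
        linarith
      · rw [Set.indicator_of_notMem (fun h => h2 h.2), max_eq_right]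
        · simp
        · push Not at h2
          rw [div_lt_iff₀ hb] at h2
          linarith
    · rw [Set.indicator_of_notMem (s := Set.Ioi 0) h0,
        Set.indicator_of_notMem (fun h => h0 h.1)]
  have hcont : Continuous fun s : ℝ => s * (a - b * s) ^ 2 := by fun_prop
  rw [h1, ← ofReal_integral_eq_lintegral_ofReal]
  · rw [← intervalIntegral.integral_of_le hab]
    congr 1
    have hd : ∀ s ∈ Set.uIcc 0 (a / b), HasDerivAt
        (fun s : ℝ => a ^ 2 * s ^ 2 / 2 - 2 * a * b * s ^ 3 / 3 + b ^ 2 * s ^ 4 / 4)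
        (s * (a - b * s) ^ 2) s := by
      intro s _
      have e2 := ((hasDerivAt_pow 2 s).const_mul (a ^ 2)).div_const 2
      have e3 := ((hasDerivAt_pow 3 s).const_mul (2 * a * b)).div_const 3
      have e4 := ((hasDerivAt_pow 4 s).const_mul (b ^ 2)).div_const 4
      refine ((e2.sub e3).add e4).congr_deriv ?_
      norm_num
      ring
    rw [intervalIntegral.integral_eq_sub_of_hasDerivAt hd (hcont.intervalIntegrable _ _)]
    field_simp
    ring
  · exact hcont.integrableOn_Icc.mono_set Set.Ioc_subset_Icc_self
  · filter_upwards [ae_restrict_mem measurableSet_Ioc] with s hs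
    have := hs.1.le
    positivity

/-- A layer-cake formula: the fourth moment is the integral over the level `s` of the second
moments of the parts above `b s`, weighted by `s`. -/
theorem lintegral_lintegral_truncated {π : Measure S} [IsProbabilityMeasure π] {k : S → ℝ}
    (hk : Measurable k) {b : ℝ} (hb : 0 < b) :
    ∫⁻ s in Set.Ioi (0 : ℝ), ∫⁻ x, ENNReal.ofReal (s * max (|k x| - b * s) 0 ^ 2) ∂π
      = ENNReal.ofReal (12 * b ^ 2)⁻¹ * ∫⁻ x, ENNReal.ofReal (k x ^ 4) ∂π := by
  rw [lintegral_lintegral_swap, ← lintegral_const_mul _ (by fun_prop)]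
  · refine lintegral_congr fun x => ?_
    rw [lintegral_mul_sq_truncated (abs_nonneg _) hb, ← ENNReal.ofReal_mul (by positivity),
      Even.pow_abs ⟨2, rfl⟩, div_eq_inv_mul]
  · refine Measurable.aemeasurable ?_
    unfold Function.uncurry
    fun_prop

theorem abs_sub_clamp (a : ℝ) {s : ℝ} (hs : 0 ≤ s) :
    |a - max (-s) (min s a)| = max (|a| - s) 0 := by
  rcases le_total a 0 with h | h <;> rcases le_total s |a| with h' | h' <;>
    simp only [abs_of_nonneg, abs_of_nonpos, h] at h' ⊢
  · rw [min_eq_right (by linarith), max_eq_left (by linarith), max_eq_left (by linarith),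
      abs_of_nonpos (by linarith)]
    ring
  · rw [min_eq_right (by linarith), max_eq_right (by linarith), max_eq_right (by linarith)]
    simp
  · rw [min_eq_left (by linarith), max_eq_right (by linarith), max_eq_left (by linarith),
      abs_of_nonneg (by linarith)]
  · rw [min_eq_right (by linarith), max_eq_right (by linarith), max_eq_right (by linarith)]
    simp

/-- Truncation estimate for `T = K - π`: the part of `h` below the level `s` contributes at most
`2 s` to `T h`, so the part of `T h` above `2 s` comes from the part of `h` above `s`, which is
controlled in `L²`. -/
theorem lintegral_sq_truncated_markovOp_le {K : Kernel S S} [IsMarkovKernel K] {π : Measure S}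
    [IsProbabilityMeasure π] (hK : K.Invariant π) {c : ℝ}
    (hgap : ∀ h : S → ℝ, Measurable h → MemLp h 2 π →
      lpNorm (fun x => markovOp K h x - ∫ y, h y ∂π) 2 π ≤ c * lpNorm h 2 π)
    {h : S → ℝ} (hh : Measurable h) (hh2 : MemLp h 2 π) {s : ℝ} (hs : 0 ≤ s) :
    ∫⁻ x, ENNReal.ofReal (max (|markovOp K h x - ∫ y, h y ∂π| - 2 * s) 0 ^ 2) ∂π
      ≤ ENNReal.ofReal (c ^ 2) * ∫⁻ x, ENNReal.ofReal (max (|h x| - s) 0 ^ 2) ∂π := by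
  set h₂ : S → ℝ := fun x => max (-s) (min s (h x)) with hh₂
  set h₁ : S → ℝ := fun x => h x - h₂ x with hh₁
  have hm₂ : Measurable h₂ := by fun_prop
  have hm₁ : Measurable h₁ := hh.sub hm₂
  have hb₂ : ∀ x, |h₂ x| ≤ s := fun x =>
    abs_le.2 ⟨le_max_left _ _, max_le (by linarith) (min_le_left _ _)⟩
  have hL₂ : MemLp h₂ 2 π :=
    MemLp.of_bound hm₂.aestronglyMeasurable s (Filter.Eventually.of_forall hb₂)
  have hL₁ : MemLp h₁ 2 π := hh2.sub hL₂
  have hI : Integrable h π := hh2.integrable one_le_two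
  have hI₂ : Integrable h₂ π := hL₂.integrable one_le_two
  have avg : ∀ (ν : Measure S) [IsProbabilityMeasure ν], |∫ y, h₂ y ∂ν| ≤ s := by
    intro ν _
    have := norm_integral_le_of_norm_le_const (μ := ν) (f := h₂) (C := s)
      (Filter.Eventually.of_forall hb₂)
    simpa using this
  have hTm : Measurable fun x => markovOp K h₁ x - ∫ y, h₁ y ∂π :=
    (measurable_markovOp K hm₁).sub_const _
  have hT₁ : MemLp (fun x => markovOp K h₁ x - ∫ y, h₁ y ∂π) 2 π :=
    (memLp_markovOp hK hm₁ one_le_two (by simp) hL₁).sub (memLp_const _)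
  have hpt : ∀ᵐ x ∂π, max (|markovOp K h x - ∫ y, h y ∂π| - 2 * s) 0 ^ 2
      ≤ (markovOp K h₁ x - ∫ y, h₁ y ∂π) ^ 2 := by
    filter_upwards [markovOp_sub_ae hK hI hI₂] with x hx
    rw [← sq_abs (markovOp K h₁ x - _)]
    refine pow_le_pow_left₀ (le_max_right _ _) (max_le ?_ (abs_nonneg _)) 2
    have e : markovOp K h x - ∫ y, h y ∂π
        = (markovOp K h₁ x - ∫ y, h₁ y ∂π) + (markovOp K h₂ x - ∫ y, h₂ y ∂π) := by
      rw [hh₁, hx, integral_sub hI hI₂]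
      ring
    have a1 : |markovOp K h₂ x| ≤ s := avg (K x)
    have a2 := avg π
    have a3 := abs_add_le (markovOp K h₁ x - ∫ y, h₁ y ∂π) (markovOp K h₂ x - ∫ y, h₂ y ∂π)
    have a4 := abs_sub (markovOp K h₂ x) (∫ y, h₂ y ∂π)
    rw [e]
    linarith
  calc _ ≤ ∫⁻ x, ENNReal.ofReal ((markovOp K h₁ x - ∫ y, h₁ y ∂π) ^ 2) ∂π :=
        lintegral_mono_ae (hpt.mono fun x hx => ENNReal.ofReal_le_ofReal hx)
    _ = ENNReal.ofReal (lpNorm (fun x => markovOp K h₁ x - ∫ y, h₁ y ∂π) 2 π ^ 2) := by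
        rw [lpNorm_two_sq hT₁, ofReal_integral_eq_lintegral_ofReal hT₁.integrable_sq
          (Filter.Eventually.of_forall fun x => sq_nonneg _)]
    _ ≤ ENNReal.ofReal ((c * lpNorm h₁ 2 π) ^ 2) := by
        gcongr
        · exact lpNorm_nonneg
        · exact hgap h₁ hm₁ hL₁
    _ = ENNReal.ofReal (c ^ 2) * ∫⁻ x, ENNReal.ofReal (h₁ x ^ 2) ∂π := by
        rw [mul_pow, ENNReal.ofReal_mul (sq_nonneg c), lpNorm_two_sq hL₁,
          ofReal_integral_eq_lintegral_ofReal hL₁.integrable_sq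
          (Filter.Eventually.of_forall fun x => sq_nonneg _)]
    _ = _ := by
        congr 1
        refine lintegral_congr fun x => ?_
        rw [← sq_abs, hh₁, hh₂]
        simp only
        rw [abs_sub_clamp _ hs]

/-- Integrating the truncation estimate against `s ds` gives an `L⁴` bound with the constant
`4 c²`, the one that Riesz–Thorin interpolation would give. -/
theorem lpNorm_four_markovOp_sub_pow_le {K : Kernel S S} [IsMarkovKernel K] {π : Measure S}
    [IsProbabilityMeasure π] (hK : K.Invariant π) {c : ℝ}
    (hgap : ∀ h : S → ℝ, Measurable h → MemLp h 2 π →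
      lpNorm (fun x => markovOp K h x - ∫ y, h y ∂π) 2 π ≤ c * lpNorm h 2 π)
    {h : S → ℝ} (hh : Measurable h) (hh4 : MemLp h 4 π) :
    lpNorm (fun x => markovOp K h x - ∫ y, h y ∂π) 4 π ^ 4 ≤ 4 * c ^ 2 * lpNorm h 4 π ^ 4 := by
  have hh2 : MemLp h 2 π := hh4.mono_exponent (by norm_num)
  set T : S → ℝ := fun x => markovOp K h x - ∫ y, h y ∂π with hT
  have hTm : Measurable T := (measurable_markovOp K hh).sub_const _
  have hT4 : MemLp T 4 π := (memLp_markovOp hK hh (by norm_num) (by simp) hh4).sub (memLp_const _)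
  have four : ∀ {k : S → ℝ}, MemLp k 4 π →
      ENNReal.ofReal (lpNorm k 4 π ^ 4) = ∫⁻ x, ENNReal.ofReal (k x ^ 4) ∂π := by
    intro k hk
    rw [lpNorm_four_pow hk, ofReal_integral_eq_lintegral_ofReal]
    · have := hk.integrable_norm_pow (p := 4) (by norm_num)
      simpa [Even.pow_abs (⟨2, rfl⟩ : Even 4)] using this
    · exact Filter.Eventually.of_forall fun x => Even.pow_nonneg ⟨2, rfl⟩ _
  have pull : ∀ {k : S → ℝ} (_ : Measurable k) (b : ℝ) {s : ℝ}, 0 ≤ s →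
      ∫⁻ x, ENNReal.ofReal (s * max (|k x| - b * s) 0 ^ 2) ∂π
        = ENNReal.ofReal s * ∫⁻ x, ENNReal.ofReal (max (|k x| - b * s) 0 ^ 2) ∂π := by
    intro k hk b s hs
    rw [← lintegral_const_mul _ (by fun_prop)]
    exact lintegral_congr fun x => ENNReal.ofReal_mul hs
  have key : ∫⁻ s in Set.Ioi (0 : ℝ), ∫⁻ x, ENNReal.ofReal (s * max (|T x| - 2 * s) 0 ^ 2) ∂π
      ≤ ENNReal.ofReal (c ^ 2) *
        ∫⁻ s in Set.Ioi (0 : ℝ), ∫⁻ x, ENNReal.ofReal (s * max (|h x| - 1 * s) 0 ^ 2) ∂π := by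
    rw [← lintegral_const_mul' _ _ ENNReal.ofReal_ne_top]
    refine setLIntegral_mono_ae' measurableSet_Ioi (Filter.Eventually.of_forall fun s hs => ?_)
    have hs : 0 ≤ s := le_of_lt hs
    rw [pull hTm 2 hs, pull hh 1 hs, one_mul, mul_left_comm]
    gcongr
    exact lintegral_sq_truncated_markovOp_le hK hgap hh hh2 hs
  rw [lintegral_lintegral_truncated hTm two_pos, lintegral_lintegral_truncated hh one_pos,
    ← four hT4, ← four hh4, ← ENNReal.ofReal_mul (by positivity),
    ← ENNReal.ofReal_mul (by positivity), ← ENNReal.ofReal_mul (by positivity),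
    ENNReal.ofReal_le_ofReal_iff (by have := lpNorm_nonneg (f := h) (p := 4) (μ := π); positivity)]
    at key
  norm_num at key
  linarith

end Interpolation

/-! ### Two-point laws of a Markov chain -/

section Chain

variable {S : Type*} [MeasurableSpace S]

namespace IsMarkovChain

variable {Ω : Type*} [MeasurableSpace Ω] {X : ℕ → Ω → S} {μ : Measure S} {P : Kernel S S}
  {Q : Measure Ω}

theorem aemeasurable (hX : IsMarkovChain X μ P Q) (n : ℕ) : AEMeasurable (X n) Q := by
  cases n with
  | zero => exact hX.initial.aemeasurable
  | succ n => exact (hX.step n).aemeasurable_snd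

theorem map_pair [IsMarkovKernel P] [IsProbabilityMeasure Q] (hX : IsMarkovChain X μ P Q)
    (j m : ℕ) : Q.map (fun ω => (X j ω, X (j + m) ω)) = (Q.map (X j)) ⊗ₘ (P ^ m) := by
  have hm := hX.aemeasurable
  have := isMarkovKernel_pow P m
  have : IsProbabilityMeasure (Q.map (X j)) := Measure.isProbabilityMeasure_map (hm j)
  induction m with
  | zero =>
    have e : P ^ 0 = Kernel.id := pow_zero P
    rw [e, Measure.compProd_id, AEMeasurable.map_map_of_aemeasurable (by fun_prop) (hm j)]
    rfl
  | succ m ih =>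
    have := isMarkovKernel_pow P m
    have := isMarkovKernel_pow P (m + 1)
    have : IsProbabilityMeasure (Q.map fun ω => (X j ω, X (j + (m + 1)) ω)) :=
      Measure.isProbabilityMeasure_map ((hm _).prodMk (hm _))
    refine Measure.ext_prod fun {A B} hA hB => ?_
    set hist : Ω → (Finset.Iic (j + m) → S) := fun ω i => X i ω with hhist
    have hhm : AEMeasurable hist Q := (hX.step (j + m)).aemeasurable_fst
    have : IsProbabilityMeasure (Q.map hist) := Measure.isProbabilityMeasure_map hhm
    set ej : (Finset.Iic (j + m) → S) → S := fun h => h ⟨j, Finset.mem_Iic.2 (by omega)⟩ with hej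
    have hejm : Measurable ej := measurable_pi_apply _
    have hlaw := (hX.step (j + m)).map_eq
    calc Q.map (fun ω => (X j ω, X (j + (m + 1)) ω)) (A ×ˢ B)
        = Q.map (fun ω => (hist ω, X (j + m + 1) ω)) ((ej ⁻¹' A) ×ˢ B) := by
          rw [Measure.map_apply_of_aemeasurable ((hm _).prodMk (hm _)) (hA.prod hB),
            Measure.map_apply_of_aemeasurable (hhm.prodMk (hm _)) ((hejm hA).prod hB)]
          rfl
      _ = ∫⁻ h, A.indicator 1 (ej h) *
            P (h ⟨j + m, Finset.mem_Iic.2 le_rfl⟩) B ∂(Q.map hist) := by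
          rw [hlaw, Measure.compProd_apply_prod (hejm hA) hB, ← lintegral_indicator (hejm hA)]
          refine lintegral_congr fun h => ?_
          by_cases hh : ej h ∈ A
          · rw [Set.indicator_of_mem (Set.mem_preimage.2 hh), Set.indicator_of_mem hh]
            simp
          · rw [Set.indicator_of_notMem (s := ej ⁻¹' A) hh, Set.indicator_of_notMem (s := A) hh,
              zero_mul]
      _ = ∫⁻ ω, A.indicator 1 (X j ω) * P (X (j + m) ω) B ∂Q := by
          rw [lintegral_map' _ hhm]
          refine Measurable.aemeasurable (Measurable.mul ?_ ?_)
          · exact (measurable_one.indicator hA).comp hejm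
          · exact (Kernel.measurable_coe P hB).comp (measurable_pi_apply _)
      _ = ∫⁻ z, A.indicator 1 z.1 * P z.2 B ∂(Q.map fun ω => (X j ω, X (j + m) ω)) := by
          rw [lintegral_map' _ ((hm _).prodMk (hm _))]
          refine Measurable.aemeasurable (Measurable.mul ?_ ?_)
          · exact (measurable_one.indicator hA).comp measurable_fst
          · exact (Kernel.measurable_coe P hB).comp measurable_snd
      _ = ∫⁻ x, ∫⁻ y, A.indicator 1 x * P y B ∂(P ^ m) x ∂(Q.map (X j)) := by
          rw [ih inferInstance, Measure.lintegral_compProd]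
          refine Measurable.mul ?_ ?_
          · exact (measurable_one.indicator hA).comp measurable_fst
          · exact (Kernel.measurable_coe P hB).comp measurable_snd
      _ = _ := by
          rw [Measure.compProd_apply_prod hA hB, ← lintegral_indicator hA]
          refine lintegral_congr fun x => ?_
          rw [lintegral_const_mul _ (Kernel.measurable_coe P hB),
            ← Kernel.pow_succ_apply_eq_lintegral _ _ _ hB]
          by_cases hx : x ∈ A <;> simp [hx]

theorem map_eq [IsMarkovKernel P] [IsProbabilityMeasure Q] (hX : IsMarkovChain X μ P Q)
    (n : ℕ) : Q.map (X n) = (P ^ n) ∘ₘ μ := by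
  have hm := hX.aemeasurable
  have := isMarkovKernel_pow P n
  have : IsProbabilityMeasure (Q.map (X 0)) := Measure.isProbabilityMeasure_map (hm 0)
  have h := congrArg Measure.snd (hX.map_pair 0 n)
  rw [Measure.snd_compProd, Measure.snd_map_prodMk₀ (hm 0), hX.initial.map_eq, zero_add] at h
  exact h

end IsMarkovChain

/-! ### Covariances along the chain -/

theorem comp_eq_withDensity_markovOp {K : Kernel S S} [IsMarkovKernel K] {π : Measure S}
    [IsProbabilityMeasure π] (h : K.IsReversible π) {μ : Measure S} [IsProbabilityMeasure μ]
    (hμ : MeasureMemL2 π μ) :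
    K ∘ₘ μ = π.withDensity
      (fun x => ENNReal.ofReal (markovOp K (fun y => (μ.rnDeriv π y).toReal) x)) := by
  have hd : Measurable fun y => (μ.rnDeriv π y).toReal :=
    (Measure.measurable_rnDeriv μ π).ennreal_toReal
  conv_lhs => rw [← hμ.withDensity_toReal_rnDeriv]
  rw [comp_withDensity_of_isReversible h hd.ennreal_ofReal]
  refine withDensity_congr_ae ?_
  filter_upwards [ae_integrable_kernel h.invariant (hμ.2.integrable one_le_two)] with x hx
  exact (ofReal_integral_eq_lintegral_ofReal hx
    (Filter.Eventually.of_forall fun _ => ENNReal.toReal_nonneg)).symm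

theorem integrable_comp_of_memLp {K : Kernel S S} [IsMarkovKernel K] {π : Measure S}
    [IsProbabilityMeasure π] (h : K.IsReversible π) {μ : Measure S} [IsProbabilityMeasure μ]
    (hμ : MeasureMemL2 π μ) {u : S → ℝ} (hu : MemLp u 2 π) :
    Integrable u (K ∘ₘ μ) := by
  set d : S → ℝ := fun y => (μ.rnDeriv π y).toReal with hd
  have hdm : Measurable d := (Measure.measurable_rnDeriv μ π).ennreal_toReal
  have hp := memLp_markovOp h.invariant hdm one_le_two (by simp) hμ.2
  have hp0 : ∀ x, 0 ≤ markovOp K d x := fun x => integral_nonneg fun _ => ENNReal.toReal_nonneg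
  rw [comp_eq_withDensity_markovOp h hμ, integrable_withDensity_iff
    (measurable_markovOp K hdm).ennreal_ofReal (by simp)]
  simpa [ENNReal.toReal_ofReal (hp0 _)] using hu.integrable_two_mul hp

theorem integral_comp_eq {K : Kernel S S} [IsMarkovKernel K] {π : Measure S}
    [IsProbabilityMeasure π] (h : K.IsReversible π) {μ : Measure S} [IsProbabilityMeasure μ]
    (hμ : MeasureMemL2 π μ) (u : S → ℝ) :
    ∫ x, u x ∂(K ∘ₘ μ) = ∫ x, u x * markovOp K (fun y => (μ.rnDeriv π y).toReal) x ∂π := by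
  set d : S → ℝ := fun y => (μ.rnDeriv π y).toReal with hd
  have hdm : Measurable d := (Measure.measurable_rnDeriv μ π).ennreal_toReal
  have hp0 : ∀ x, 0 ≤ markovOp K d x := fun x => integral_nonneg fun _ => ENNReal.toReal_nonneg
  rw [comp_eq_withDensity_markovOp h hμ, integral_withDensity_eq_integral_toReal_smul
    (measurable_markovOp K hdm).ennreal_ofReal (by simp)]
  refine integral_congr_ae (Filter.Eventually.of_forall fun x => ?_)
  simp only [ENNReal.toReal_ofReal (hp0 _), smul_eq_mul]
  ring

/-- The law of the chain at time `j` differs from `π` by at most `ρʲ ‖μ - π‖₂` when tested against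
functions in `L²(π)`. -/
theorem IsL2GeometricallyErgodic.abs_integral_comp_sub_le {P : Kernel S S} [IsMarkovKernel P]
    {π : Measure S} [IsProbabilityMeasure π] (hrev : P.IsReversible π) {ρ : ℝ} (hρ : 0 < ρ)
    (hgeo : IsL2GeometricallyErgodic P π ρ) {μ : Measure S} [IsProbabilityMeasure μ]
    (hμ : MeasureMemL2 π μ) {u : S → ℝ} (hu : MemLp u 2 π) (j : ℕ) :
    |∫ x, u x ∂((P ^ j) ∘ₘ μ) - ∫ x, u x ∂π|
      ≤ lpNorm u 2 π * (ρ ^ j * (measureL2Dist π μ π).toReal) := by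
  have := isMarkovKernel_pow P j
  set d : S → ℝ := fun y => (μ.rnDeriv π y).toReal with hd
  have hdm : Measurable d := (Measure.measurable_rnDeriv μ π).ennreal_toReal
  have hdI : Integrable d π := hμ.2.integrable one_le_two
  have hd1 : ∫ x, d x ∂π = 1 := by
    rw [hd, Measure.integral_toReal_rnDeriv hμ.1]
    simp
  have hdm1 : Measurable fun x => d x - 1 := hdm.sub_const 1
  have hL1 : MemLp (fun x => d x - 1) 2 π := hμ.2.sub (memLp_const 1)
  have hinv := (hrev.pow j).invariant
  have hpL := memLp_markovOp hinv hdm one_le_two (by simp) hμ.2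
  have hqL := memLp_markovOp hinv hdm1 one_le_two (by simp) hL1
  have hdist : (measureL2Dist π μ π).toReal = lpNorm (fun x => d x - 1) 2 π := by
    rw [← toReal_eLpNorm hL1.1, measureL2Dist]
    congr 1
    refine eLpNorm_congr_ae ?_
    filter_upwards [Measure.rnDeriv_self π] with x hx
    simp [hd, hx]
  have hae := markovOp_sub_ae hinv hdI (integrable_const (1 : ℝ))
  rw [markovOp_const] at hae
  have e : ∫ x, u x ∂((P ^ j) ∘ₘ μ) - ∫ x, u x ∂π
      = ∫ x, u x * markovOp (P ^ j) (fun x => d x - 1) x ∂π := by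
    rw [integral_comp_eq (hrev.pow j) hμ, ← integral_sub (hu.integrable_two_mul hpL)
      (hu.integrable one_le_two)]
    refine integral_congr_ae ?_
    filter_upwards [hae] with x hx
    rw [hx]
    ring
  rw [e, hdist]
  refine (abs_integral_mul_le_lpNorm hu hqL).trans ?_
  refine mul_le_mul_of_nonneg_left ?_ lpNorm_nonneg
  refine hgeo.lpNorm_markovOp_pow_le hrev hρ hdm1 hL1 ?_ j
  rw [integral_sub hdI (integrable_const _), hd1]
  simp

theorem MeasureTheory.MemLp.sq_of_four {π : Measure S} {k : S → ℝ} (hk : MemLp k 4 π) :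
    MemLp (fun x => k x ^ 2) 2 π := by
  refine (memLp_two_iff_integrable_sq (hk.1.pow 2)).2 ?_
  have := hk.integrable_norm_pow (p := 4) (by norm_num)
  simpa [← pow_mul, Even.pow_abs (⟨2, rfl⟩ : Even 4)] using this

theorem lpNorm_two_sq_eq_four {π : Measure S} {k : S → ℝ} (hk : MemLp k 4 π) :
    lpNorm (fun x => k x ^ 2) 2 π = lpNorm k 4 π ^ 2 := by
  have h1 := lpNorm_two_sq hk.sq_of_four
  have h2 := lpNorm_four_pow hk
  refine (pow_left_inj₀ lpNorm_nonneg (by positivity) two_ne_zero).1 ?_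
  rw [h1, ← pow_mul, h2]
  simp [← pow_mul]

theorem memLp_two_mul_of_four {π : Measure S} {k l : S → ℝ} (hk : MemLp k 4 π)
    (hl : MemLp l 4 π) : MemLp (fun x => k x * l x) 2 π := by
  refine (memLp_two_iff_integrable_sq (hk.1.mul hl.1)).2 ?_
  have := hk.sq_of_four.integrable_two_mul hl.sq_of_four
  simpa [mul_pow] using this

theorem lpNorm_two_mul_le_four {π : Measure S} {k l : S → ℝ} (hk : MemLp k 4 π)
    (hl : MemLp l 4 π) :
    lpNorm (fun x => k x * l x) 2 π ≤ lpNorm k 4 π * lpNorm l 4 π := by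
  refine le_of_sq_le_sq ?_ (mul_nonneg lpNorm_nonneg lpNorm_nonneg)
  rw [lpNorm_two_sq (memLp_two_mul_of_four hk hl), mul_pow, ← lpNorm_two_sq_eq_four hk,
    ← lpNorm_two_sq_eq_four hl]
  simp_rw [mul_pow]
  exact (le_abs_self _).trans (abs_integral_mul_le_lpNorm hk.sq_of_four hl.sq_of_four)

theorem IsL2GeometricallyErgodic.lpNorm_four_markovOp_pow_le {P : Kernel S S} [IsMarkovKernel P]
    {π : Measure S} [IsProbabilityMeasure π] (hrev : P.IsReversible π) {ρ : ℝ} (hρ : 0 < ρ)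
    (hgeo : IsL2GeometricallyErgodic P π ρ) {g : S → ℝ} (hg : Measurable g)
    (hg4 : MemLp g 4 π) (hg0 : ∫ x, g x ∂π = 0) (m : ℕ) :
    lpNorm (markovOp (P ^ m) g) 4 π ≤ √2 * √ρ ^ m * lpNorm g 4 π := by
  have := isMarkovKernel_pow P m
  have h := lpNorm_four_markovOp_sub_pow_le (hrev.pow m).invariant (c := ρ ^ m)
    (fun h hh hh2 => hgeo.lpNorm_markovOp_pow_sub_le hrev hρ hh hh2 m) hg hg4
  simp only [hg0, sub_zero] at h
  have hG : 0 ≤ lpNorm g 4 π := lpNorm_nonneg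
  refine le_of_pow_le_pow_left₀ (n := 4) (by norm_num) (by positivity) (h.trans (le_of_eq ?_))
  have e2 : √2 ^ 4 = 4 := by
    rw [show √2 ^ 4 = (√2 ^ 2) ^ 2 by ring, Real.sq_sqrt (by norm_num)]; norm_num
  have eρ : (√ρ ^ m) ^ 4 = (ρ ^ m) ^ 2 := by
    rw [← pow_mul, ← pow_mul, show m * 4 = 2 * (m * 2) by ring, pow_mul, Real.sq_sqrt hρ.le]
  rw [mul_pow, mul_pow, e2, eρ]

/-- The covariance bound: the first term is the stationary covariance, the second the effect of
starting from `μ` instead of `π`. -/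
theorem IsMarkovChain.integral_mul_le {P : Kernel S S} [IsMarkovKernel P]
    {π : Measure S} [IsProbabilityMeasure π] (hrev : P.IsReversible π) {ρ : ℝ} (hρ : 0 < ρ)
    (hgeo : IsL2GeometricallyErgodic P π ρ) {μ : Measure S} [IsProbabilityMeasure μ]
    (hμ : MeasureMemL2 π μ) {g : S → ℝ} (hg : Measurable g) (hg4 : MemLp g 4 π)
    (hg0 : ∫ x, g x ∂π = 0) {Ω : Type*} [MeasurableSpace Ω] {Q : Measure Ω}
    [IsProbabilityMeasure Q] {X : ℕ → Ω → S} (hX : IsMarkovChain X μ P Q) (j m : ℕ)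
    (hint : Integrable (fun ω => g (X j ω) * g (X (j + m) ω)) Q) :
    ∫ ω, g (X j ω) * g (X (j + m) ω) ∂Q
      ≤ lpNorm g 2 π ^ 2 * ρ ^ m
        + √2 * (measureL2Dist π μ π).toReal * lpNorm g 4 π ^ 2 * (ρ ^ j * √ρ ^ m) := by
  have := isMarkovKernel_pow P m
  have hm := hX.aemeasurable
  have : IsProbabilityMeasure (Q.map (X j)) := Measure.isProbabilityMeasure_map (hm j)
  have hg2 : MemLp g 2 π := hg4.mono_exponent (by norm_num)
  have hinv := (hrev.pow m).invariant
  have hPg2 := memLp_markovOp hinv hg one_le_two (by simp) hg2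
  have hPg4 := memLp_markovOp hinv hg (by norm_num) (by simp) hg4
  have hpair : AEMeasurable (fun ω => (X j ω, X (j + m) ω)) Q := (hm _).prodMk (hm _)
  have hgg : Measurable fun z : S × S => g z.1 * g z.2 := by fun_prop
  have e1 : ∫ ω, g (X j ω) * g (X (j + m) ω) ∂Q
      = ∫ x, g x * markovOp (P ^ m) g x ∂((P ^ j) ∘ₘ μ) := by
    have h1 := integral_map hpair (f := fun z : S × S => g z.1 * g z.2)
      hgg.aestronglyMeasurable
    have h2 : Integrable (fun z : S × S => g z.1 * g z.2) (Q.map (X j) ⊗ₘ (P ^ m)) := by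
      rw [← hX.map_pair]
      exact (integrable_map_measure hgg.aestronglyMeasurable hpair).2 hint
    rw [← h1, hX.map_pair, Measure.integral_compProd h2, hX.map_eq]
    refine integral_congr_ae (Filter.Eventually.of_forall fun x => ?_)
    simp only [markovOp, integral_const_mul]
  have b1 : ∫ x, g x * markovOp (P ^ m) g x ∂π ≤ lpNorm g 2 π ^ 2 * ρ ^ m := by
    have h1 := (le_abs_self _).trans (abs_integral_mul_le_lpNorm hg2 hPg2)
    have h2 := mul_le_mul_of_nonneg_left
      (hgeo.lpNorm_markovOp_pow_le hrev hρ hg hg2 hg0 m) (lpNorm_nonneg (f := g) (p := 2) (μ := π))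
    linarith
  have b2 := (le_abs_self _).trans
    (hgeo.abs_integral_comp_sub_le hrev hρ hμ (memLp_two_mul_of_four hg4 hPg4) j)
  have b3 : lpNorm (fun x => g x * markovOp (P ^ m) g x) 2 π
      ≤ lpNorm g 4 π * (√2 * √ρ ^ m * lpNorm g 4 π) :=
    (lpNorm_two_mul_le_four hg4 hPg4).trans (mul_le_mul_of_nonneg_left
      (hgeo.lpNorm_four_markovOp_pow_le hrev hρ hg hg4 hg0 m) lpNorm_nonneg)
  have b4 := mul_le_mul_of_nonneg_right b3
    (show 0 ≤ ρ ^ j * (measureL2Dist π μ π).toReal by positivity)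
  rw [e1]
  linarith

end Chain

/-! ### Summation of the covariances -/

/-- A symmetric double sum is at most twice the sum over the pairs `(j, j + m)`; extending `m` over
all of `range t` only adds nonnegative terms. -/
theorem sum_sum_le_two_mul_of_symm {a c : ℕ → ℕ → ℝ} (hsymm : ∀ j k, a j k = a k j)
    (hac : ∀ j m, a j (j + m) ≤ c j m) (hc : ∀ j m, 0 ≤ c j m) (t : ℕ) :
    ∑ j ∈ Finset.range t, ∑ k ∈ Finset.range t, a j k
      ≤ 2 * ∑ j ∈ Finset.range t, ∑ m ∈ Finset.range t, c j m := by
  set b : ℕ → ℕ → ℝ := fun j k => if j ≤ k then c j (k - j) else 0 with hb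
  have hb0 : ∀ j k, 0 ≤ b j k := fun j k => by
    simp only [hb]
    split_ifs
    exacts [hc _ _, le_rfl]
  have hle : ∀ j k, j ≤ k → a j k ≤ b j k := fun j k hjk => by
    simp only [hb, if_pos hjk]
    have := hac j (k - j)
    rwa [Nat.add_sub_cancel' hjk] at this
  have hab : ∀ j k, a j k ≤ b j k + b k j := fun j k => by
    rcases le_total j k with h | h
    · linarith [hle j k h, hb0 k j]
    · linarith [hsymm j k, hle k j h, hb0 j k]
  have hrow : ∀ j, ∑ k ∈ Finset.range t, b j k ≤ ∑ m ∈ Finset.range t, c j m := fun j => by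
    have e : ∑ k ∈ Finset.range t, b j k = ∑ k ∈ Finset.Ico j t, c j (k - j) := by
      rw [← Finset.sum_filter]
      refine Finset.sum_congr ?_ fun _ _ => rfl
      ext k
      simp [and_comm]
    rw [e, Finset.sum_Ico_eq_sum_range]
    simp only [Nat.add_sub_cancel_left]
    exact Finset.sum_le_sum_of_subset_of_nonneg
      (Finset.range_subset_range.2 (Nat.sub_le _ _)) fun _ _ _ => hc _ _
  have hrows := Finset.sum_le_sum fun j (_ : j ∈ Finset.range t) => hrow j
  calc _ ≤ ∑ j ∈ Finset.range t, ∑ k ∈ Finset.range t, (b j k + b k j) :=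
        Finset.sum_le_sum fun j _ => Finset.sum_le_sum fun k _ => hab j k
    _ = 2 * ∑ j ∈ Finset.range t, ∑ k ∈ Finset.range t, b j k := by
        simp only [Finset.sum_add_distrib]
        rw [Finset.sum_comm (f := fun j k => b k j)]
        ring
    _ ≤ _ := by linarith

theorem geom_sum_le_inv {r δ : ℝ} (hr : 0 ≤ r) (hδ : 0 < δ) (h : δ ≤ 1 - r) (t : ℕ) :
    ∑ m ∈ Finset.range t, r ^ m ≤ 1 / δ := by
  rw [le_div_iff₀ hδ]
  have h1 := geom_sum_mul_neg r t
  have h2 : 0 ≤ ∑ m ∈ Finset.range t, r ^ m := Finset.sum_nonneg fun m _ => by positivity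
  have h3 := mul_le_mul_of_nonneg_left h h2
  have h4 : 0 ≤ r ^ t := by positivity
  linarith

theorem sum_sum_geom_le {α A E : ℝ} (hα0 : 0 < α) (hα1 : α < 1) (hA : 0 ≤ A) (hE : 0 ≤ E)
    (t : ℕ) :
    ∑ j ∈ Finset.range t, ∑ m ∈ Finset.range t,
        (A * (1 - α) ^ m + E * ((1 - α) ^ j * √(1 - α) ^ m))
      ≤ A * t / α + 2 * E / α ^ 2 := by
  have hρ : 0 ≤ 1 - α := by linarith
  -- `1 - √(1 - α) = α / (1 + √(1 - α)) ≥ α / 2`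
  have hσ : α / 2 ≤ 1 - √(1 - α) := by
    have h1 : √(1 - α) ≤ 1 - α / 2 := by
      refine Real.sqrt_le_iff.2 ⟨by linarith, ?_⟩
      nlinarith [sq_nonneg α]
    linarith
  have s1 := geom_sum_le_inv hρ hα0 (by linarith) t
  have s2 := geom_sum_le_inv (Real.sqrt_nonneg _) (half_pos hα0) hσ t
  have s0 : 0 ≤ ∑ m ∈ Finset.range t, √(1 - α) ^ m := Finset.sum_nonneg fun m _ => by positivity
  simp only [Finset.sum_add_distrib, ← Finset.mul_sum, ← Finset.sum_mul, Finset.sum_const,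
    Finset.card_range, nsmul_eq_mul]
  have p1 : (t : ℝ) * (A * ∑ m ∈ Finset.range t, (1 - α) ^ m) ≤ A * t / α := by
    calc _ ≤ (t : ℝ) * (A * (1 / α)) := by gcongr
      _ = _ := by ring
  have p2 : E * ((∑ j ∈ Finset.range t, (1 - α) ^ j) * ∑ m ∈ Finset.range t, √(1 - α) ^ m)
      ≤ 2 * E / α ^ 2 := by
    calc _ ≤ E * (1 / α * (1 / (α / 2))) := by gcongr
      _ = _ := by field_simp
  linarith

/-! ### The mean square error -/

theorem IsMarkovChain.integrable_sq_comp {S : Type*} [MeasurableSpace S] {P : Kernel S S}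
    [IsMarkovKernel P] {π : Measure S} [IsProbabilityMeasure π] (hrev : P.IsReversible π)
    {μ : Measure S} [IsProbabilityMeasure μ] (hμ : MeasureMemL2 π μ) {g : S → ℝ}
    (hg4 : MemLp g 4 π) {Ω : Type*} [MeasurableSpace Ω]
    {Q : Measure Ω} [IsProbabilityMeasure Q] {X : ℕ → Ω → S} (hX : IsMarkovChain X μ P Q) (k : ℕ) :
    Integrable (fun ω => g (X k ω) ^ 2) Q := by
  have := isMarkovKernel_pow P k
  have h := integrable_comp_of_memLp (hrev.pow k) hμ hg4.sq_of_four
  rw [← hX.map_eq] at h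
  exact h.comp_aemeasurable (hX.aemeasurable k)

theorem IsMarkovChain.memLp_comp {S : Type*} [MeasurableSpace S] {P : Kernel S S}
    [IsMarkovKernel P] {π : Measure S} [IsProbabilityMeasure π] (hrev : P.IsReversible π)
    {μ : Measure S} [IsProbabilityMeasure μ] (hμ : MeasureMemL2 π μ) {g : S → ℝ}
    (hg : Measurable g) (hg4 : MemLp g 4 π) {Ω : Type*} [MeasurableSpace Ω]
    {Q : Measure Ω} [IsProbabilityMeasure Q] {X : ℕ → Ω → S} (hX : IsMarkovChain X μ P Q) (k : ℕ) :
    MemLp (fun ω => g (X k ω)) 2 Q :=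
  (memLp_two_iff_integrable_sq
    (hg.comp_aemeasurable (hX.aemeasurable k)).aestronglyMeasurable).2
    (hX.integrable_sq_comp hrev hμ hg4 k)

theorem IsMarkovChain.integral_sum_sq_le {S : Type*} [MeasurableSpace S] {P : Kernel S S}
    [IsMarkovKernel P] {π : Measure S} [IsProbabilityMeasure π] (hrev : P.IsReversible π)
    {α : ℝ} (hα0 : 0 < α) (hα1 : α < 1) (hgeo : IsL2GeometricallyErgodic P π (1 - α))
    {μ : Measure S} [IsProbabilityMeasure μ] (hμ : MeasureMemL2 π μ) {g : S → ℝ}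
    (hg : Measurable g) (hg4 : MemLp g 4 π) (hg0 : ∫ x, g x ∂π = 0)
    {Ω : Type*} [MeasurableSpace Ω] {Q : Measure Ω} [IsProbabilityMeasure Q]
    {X : ℕ → Ω → S} (hX : IsMarkovChain X μ P Q) (t : ℕ) :
    ∫ ω, (∑ k ∈ Finset.range t, g (X k ω)) ^ 2 ∂Q
      ≤ 2 * (lpNorm g 2 π ^ 2 * t / α
        + 2 * (√2 * (measureL2Dist π μ π).toReal * lpNorm g 4 π ^ 2) / α ^ 2) := by
  have hρ : 0 < 1 - α := by linarith
  have hmul : ∀ j k, Integrable (fun ω => g (X j ω) * g (X k ω)) Q := fun j k =>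
    (hX.memLp_comp hrev hμ hg hg4 j).integrable_two_mul (hX.memLp_comp hrev hμ hg hg4 k)
  have e : ∫ ω, (∑ k ∈ Finset.range t, g (X k ω)) ^ 2 ∂Q
      = ∑ j ∈ Finset.range t, ∑ k ∈ Finset.range t, ∫ ω, g (X j ω) * g (X k ω) ∂Q := by
    simp_rw [sq, Finset.sum_mul_sum]
    rw [integral_finsetSum _ fun j _ => integrable_finsetSum _ fun k _ => hmul j k]
    exact Finset.sum_congr rfl fun j _ => integral_finsetSum _ fun k _ => hmul j k
  rw [e]
  refine (sum_sum_le_two_mul_of_symm (fun j k => by simp_rw [mul_comm])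
    (fun j m => hX.integral_mul_le hrev hρ hgeo hμ hg hg4 hg0 j m (hmul _ _))
    (fun j m => by positivity) t).trans ?_
  exact mul_le_mul_of_nonneg_left
    (sum_sum_geom_le hα0 hα1 (by positivity) (by positivity) t) two_pos.le

theorem mainTheorem8 {S : Type*} [MeasurableSpace S] [MeasurableSpace.CountablyGenerated S]
    (π : Measure S) [IsProbabilityMeasure π]
    (P : Kernel S S) [IsMarkovKernel P] (hrev : P.IsReversible π)
    (α : ℝ) (hα0 : 0 < α) (hα1 : α < 1)
    (hgeo : IsL2GeometricallyErgodic P π (1 - α))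
    (μ : Measure S) [IsProbabilityMeasure μ] (hμ : MeasureMemL2 π μ)
    (f : S → ℝ) (hf : MemLp f 4 π)
    {Ω : Type*} [MeasurableSpace Ω] (Q : Measure Ω) [IsProbabilityMeasure Q]
    (X : ℕ → Ω → S) (hX : IsMarkovChain X μ P Q)
    (t : ℕ) (ht : 1 ≤ t) :
    Integrable (fun ω => ((∫ x, f x ∂π) - (1 / (t : ℝ)) * ∑ k ∈ Finset.range t, f (X k ω)) ^ 2) Q ∧
    ∫ ω, ((∫ x, f x ∂π) - (1 / (t : ℝ)) * ∑ k ∈ Finset.range t, f (X k ω)) ^ 2 ∂Q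
      ≤ 2 * lpNorm (fun x => f x - ∫ y, f y ∂π) 2 π ^ 2 / (α * t)
        + (2 : ℝ) ^ (7 / 2 : ℝ) * (measureL2Dist π μ π).toReal
            * lpNorm (fun x => f x - ∫ y, f y ∂π) 4 π ^ 2 / (α ^ 2 * (t : ℝ) ^ 2) := by
  have ht0 : (0 : ℝ) < t := by exact_mod_cast ht
  set c : ℝ := ∫ y, f y ∂π with hc
  -- `f` is only a.e. measurable for `π`; the laws of the `X k` do not see the exceptional set.
  obtain ⟨f', hf'm, hff'⟩ := hf.1.aemeasurable
  set g : S → ℝ := fun x => f' x - c with hgdef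
  have hg : Measurable g := hf'm.sub_const c
  have hfg : (fun x => f x - c) =ᵐ[π] g := hff'.mono fun x hx => by simp [hgdef, hx]
  have hfc : MemLp (fun x => f x - c) 4 π := hf.sub (memLp_const c)
  have hg4 : MemLp g 4 π := (memLp_congr_ae hfg).1 hfc
  have hg0 : ∫ x, g x ∂π = 0 := by
    rw [← integral_congr_ae hfg, integral_sub (hf.integrable (by norm_num)) (integrable_const c)]
    simp [hc]
  have hnorm : ∀ p : ℝ≥0∞, lpNorm (fun x => f x - c) p π = lpNorm g p π := fun p => by
    rw [← toReal_eLpNorm hfc.1, ← toReal_eLpNorm hg4.1, eLpNorm_congr_ae hfg]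
  have hX_ae : ∀ k, ∀ᵐ ω ∂Q, f (X k ω) - c = g (X k ω) := fun k => by
    have := isMarkovKernel_pow P k
    refine ae_of_ae_map (p := fun x => f x - c = g x) (hX.aemeasurable k) ?_
    rw [hX.map_eq, comp_eq_withDensity_markovOp (hrev.pow k) hμ]
    exact (withDensity_absolutelyContinuous _ _).ae_le hfg
  have hae : (fun ω => (c - (1 / (t : ℝ)) * ∑ k ∈ Finset.range t, f (X k ω)) ^ 2)
      =ᵐ[Q] fun ω => ((t : ℝ) ^ 2)⁻¹ * (∑ k ∈ Finset.range t, g (X k ω)) ^ 2 := by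
    filter_upwards [ae_all_iff.2 hX_ae] with ω hω
    have : ∑ k ∈ Finset.range t, g (X k ω) = (∑ k ∈ Finset.range t, f (X k ω)) - t * c := by
      simp_rw [← hω, Finset.sum_sub_distrib]
      simp
    rw [this]
    field_simp
    ring
  have hint : Integrable (fun ω => (∑ k ∈ Finset.range t, g (X k ω)) ^ 2) Q :=
    (memLp_finsetSum _ fun k _ => hX.memLp_comp hrev hμ hg hg4 k).integrable_sq
  refine ⟨(integrable_congr hae).2 (hint.const_mul _), ?_⟩
  rw [integral_congr_ae hae, integral_const_mul, hnorm, hnorm]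
  have hmain := hX.integral_sum_sq_le hrev hα0 hα1 hgeo hμ hg hg4 hg0 t
  have h2 : (2 : ℝ) ^ (7 / 2 : ℝ) = 8 * √2 := by
    rw [show (7 / 2 : ℝ) = 3 + 1 / 2 by norm_num, Real.rpow_add two_pos, ← Real.sqrt_eq_rpow]
    norm_num
  set A := lpNorm g 2 π ^ 2
  set E := √2 * (measureL2Dist π μ π).toReal * lpNorm g 4 π ^ 2 with hE
  have hE0 : 0 ≤ E := by positivity
  calc _ ≤ ((t : ℝ) ^ 2)⁻¹ * (2 * (A * t / α + 2 * E / α ^ 2)) := by gcongr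
    _ = 2 * A / (α * t) + 4 * E / (α ^ 2 * (t : ℝ) ^ 2) := by
      field_simp
      ring
    _ ≤ 2 * A / (α * t) + 8 * E / (α ^ 2 * (t : ℝ) ^ 2) := by
      gcongr
      norm_num
    _ = _ := by
      rw [h2, hE]
      ring
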